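/- \textbf{Theorem.} Let $p,q\in\mathbb C$ with $0<|p|,|q|<1$, and let $\sum_{n\ge 0}\alpha_nx^n$ be a complex power series with radius of convergence $R$, $0<R<\infty$, where $R\neq q^n$ for all $n\ge 0$. Assume that $\lim_{n\to\infty}\alpha_{n+1}/\alpha_n=c_0$ and that there are constants $m,M$ with $0<m|c_0|^n\le|\alpha_n|\le M|c_0|^n$ for all $n\ge0$. Let $F:\mathbb C\to\mathbb C$ be any function with $F(x)=\sum_{n\ge0}\alpha_nx^n$ for $|x|<R$ (the values of $F$ at points with $|x|\ge R$ are arbitrary). Notation: $(a;q)_n=\prod_{i=0}^{n-1}(1-aq^i)$ for $n\ge0$, $(a;q)_{-1}=1/(1-a/q)$ (and likewise for the bases $p$ and $p^{-1}$), ${n\brack k}_q=\frac{(q;q)_n}{(q;q)_k(q;q)_{n-k}}$, and $\mathcal D_qH(x)=\frac{H(x)-H(qx)}{x}$ for $x\ne0$. Then the following hold, all series being absolutely convergent. (1) (Gessel--Stanton.) For every $A\in\mathbb C$ with $A\ne1$ and every $x$ with $|x|<R$ and $Ap^ix\neq1$ for all $i\ge1$, $$F(x)=\sum_{k=0}^\infty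 G_3(k)\,(1-Ap^kq^k)\,\frac{\prod_{i=0}^{k-1}(q^i-x)}{(q;q)_k(Apx;p)_k},$$ $$G_3(n)=\sum_{k=0}^n(-1)^{n-k}q^{\binom{k+1}2-nk}{n\brack k}_q(Apq^k;p)_{n-1}F(q^k).$$ This is the analytic form of the Gessel--Stanton $q$-Lagrange inversion: if $Ap^kq^k\ne1$ for all $k\ge0$, then for all complex sequences $(u_n),(v_n)$, $$u_n=\sum_{k=0}^n\frac{(Ap^kq^k;p)_{n-k}}{(q;q)_{n-k}}q^{-nk}v_k\quad\text{for all }n\ge0$$ if and only if $$v_n=\sum_{k=0}^n(-1)^{n-k}q^{\binom{n-k+1}2+nk}\frac{(1-Ap^kq^k)(Aq^np^{n-1};p^{-1})_{n-k-1}}{(q;q)_{n-k}}u_k\quad\text{for all }n\ge0.$$ (2) (Liu.) For every $a\in\mathbb C\setminus\{0,1\}$ and every $x\neq0$ with $|x|<R$ and $xq^i\ne1$ for all $i\ge0$, $$F(x)=\sum_{k=0}^\infty G_4(k)\frac{(1-aq^{2k})(aq/x;q)_k\,x^k}{(q;q)_k(x;q)_k},$$ $$G_4(n)=\frac1{a^nq^n}\sum_{k=0}^n(-1)^kq^{\binom{k+1}2-nk}{n\brack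 k}_q(aq^{k+1};q)_{n-1}F(aq^{k+1}),$$ and $G_4(n)=\bigl[\mathcal D_q^n\{F(x)(x;q)_{n-1}\}\bigr]_{x=aq}$ for all $n\ge 0$. (3) (Carlitz.) For every $k\ge0$ the limit $C_k=\lim_{x\to0,\,x\ne0}\mathcal D_q^k\{F(x)(x;q)_{k-1}\}$ exists, and for every $x$ with $|x|<R$ and $xq^i\neq1$ for all $i\ge0$, $$F(x)=\sum_{k=0}^\infty\frac{x^k}{(q;q)_k(x;q)_k}\,C_k.$$ -/

import Mathlib

open Filter Topology

noncomputable section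

/-- The `q`-shifted factorial `(a;q)_n` for an integer index `n`: for `n ≥ 0` it is
`(1-a)(1-aq)⋯(1-aq^{n-1})`, and `(a;q)_{-m} = 1/((1-aq^{-1})⋯(1-aq^{-m}))`.  For `0 < |q| < 1`
this is `(a;q)_∞ / (aq^n;q)_∞` wherever that quotient is defined. -/
def qPoch (a q : ℂ) : ℤ → ℂ
  | Int.ofNat n => ∏ i ∈ Finset.range n, (1 - a * q ^ i)
  | Int.negSucc n => (∏ i ∈ Finset.range (n + 1), (1 - a * (q⁻¹) ^ (i + 1)))⁻¹

/-- The `q`-binomial coefficient `(q;q)_n / ((q;q)_k (q;q)_{n-k})`, for `k ≤ n`. -/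
def qBinom (q : ℂ) (n k : ℕ) : ℂ :=
  qPoch q q n / (qPoch q q k * qPoch q q ((n : ℤ) - k))

/-- The `q`-difference operator `F ↦ (F(x) - F(qx))/x`, used only at points `x ≠ 0`
(values at `0` are taken as limits). -/
def qDiff (q : ℂ) (F : ℂ → ℂ) : ℂ → ℂ := fun x => (F x - F (q * x)) / x

/-- The coefficients `G₃(n)` of the expansion with nodes `q^i` and poles `1/(A p^i)`. -/
def coeffG3 (p q A : ℂ) (F : ℂ → ℂ) (n : ℕ) : ℂ :=
  ∑ k ∈ Finset.range (n + 1),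
    (-1) ^ (n - k) * q ^ (((k + 1).choose 2 : ℤ) - n * k) * qBinom q n k *
      qPoch (A * p * q ^ k) p ((n : ℤ) - 1) * F (q ^ k)

/-- The coefficients `G₄(n)` of Liu's expansion. -/
def coeffG4 (q a : ℂ) (F : ℂ → ℂ) (n : ℕ) : ℂ :=
  1 / (a ^ n * q ^ n) * ∑ k ∈ Finset.range (n + 1),
    (-1) ^ k * q ^ (((k + 1).choose 2 : ℤ) - n * k) * qBinom q n k *
      qPoch (a * q ^ (k + 1)) q ((n : ℤ) - 1) * F (a * q ^ (k + 1))

/-- The entries (for `k ≤ n`) of the Gessel--Stanton matrix. -/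
def gsMatrix (p q A : ℂ) (n k : ℕ) : ℂ :=
  qPoch (A * p ^ k * q ^ k) p ((n : ℤ) - k) / qPoch q q ((n : ℤ) - k) *
    q ^ (-((n : ℤ) * k))

/-- The entries (for `k ≤ n`) of the inverse Gessel--Stanton matrix. -/
def gsMatrixInv (p q A : ℂ) (n k : ℕ) : ℂ :=
  (-1) ^ (n - k) * q ^ ((n - k + 1).choose 2 + n * k) *
    ((1 - A * p ^ k * q ^ k) *
        qPoch (A * q ^ n * p ^ ((n : ℤ) - 1)) p⁻¹ ((n : ℤ) - k - 1) /
      qPoch q q ((n : ℤ) - k))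

end

/-!
All three expansions come from one expansion of the Cauchy kernel. For nodes `z i → 0` and
parameters `b i → 0`, put

  `E n = (w - x)⁻¹ * ∏ i < n, (x - z i) (1 - b i w) / ((w - z i) (1 - b i x))`

(`kernelError` below).

Then `E n - E (n + 1)` is a product of a rational function of `x` (`ratBasis`) and a rational
function of `w` (`kernelError_sub_succ`). If `‖x‖ < ‖w‖`, the factors tend to `x / w`, so `E n`
decays geometrically, uniformly for `w` on a circle; integrating the telescoping series against a
density gives `hasSum_circleIntegral_kernel`. By partial fractions the integrals of the functions
of `w` are divided differences at the nodes `z 0, …, z n` (`dividedDiff_cauchyIntegral`), and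
Cauchy's formula turns the result into an interpolation series for a holomorphic function.

The nodes may lie outside of the disc where `F` is the sum of its power series, and there the
values of `F` are arbitrary. Choose a circle around `0` between `x` and the boundary of the disc
that avoids all nodes. On the nodes, `F` agrees with the Cauchy integral over this circle up to a
combination of functions supported at one of the finitely many nodes outside. Each of those is a
Cauchy integral over a small circle around that node, and its expansion at `x` sums to `0`
(`hasSum_dividedDiff_single`). This gives `hasSum_dividedDiff`, which with nodes `c q ^ i` is the
first expansion (`c = 1`, `b i = A p ^ i`) and Liu's expansion (`c = a q`, `b i = q ^ (i - 1)`),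
in both cases with `b 0 = 0`.

The explicit sums defining the coefficients are divided differences because the nodal weights at
geometric nodes are signed `q`-binomial coefficients (`nodalWeight_mul_pow`). Iterated
`q`-differences are divided differences too, because they satisfy the same recursion
(`iterate_qDiff`). Carlitz's expansion is the kernel expansion with all nodes equal to `0`; its
`k`-th coefficient is `(q;q)_k` times the `k`-th Taylor coefficient of `F(x) (x;q)_{k-1}` (of `F`
for `k = 0`), and Cauchy's integral for the latter is the limit of contour integrals representing
the `k`-th `q`-differences.

In the inversion theorem, the off-diagonal entries of the product of the two triangular matrices
are divided differences of order `m + 1` of polynomials of degree at most `m`, so they vanish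
(`sum_gsMatrix_mul_gsMatrixInv`).
-/

noncomputable section

/-! ### Interpolation at nodes `z i` with poles at `1 / b i` -/

/-- The divided difference `g[z 0, …, z n]` of `g` at distinct nodes `z 0, …, z n`. -/
def dividedDiff (z : ℕ → ℂ) (n : ℕ) (g : ℂ → ℂ) : ℂ :=
  ∑ k ∈ Finset.range (n + 1), Lagrange.nodalWeight (Finset.range (n + 1)) z k * g (z k)

/-- The polynomial `(1 - b 0 w) ⋯ (1 - b (n-1) w)`. -/
def poleProd (b : ℕ → ℂ) (n : ℕ) (w : ℂ) : ℂ := ∏ i ∈ Finset.range n, (1 - b i * w)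

/-- The rational function `(x - z 0) ⋯ (x - z (n-1)) / ((1 - b 0 x) ⋯ (1 - b n x))`, normalised
by the constant `1 - b n z n`, which multiplies the `n`-th divided difference in the expansion. -/
def ratBasis (b z : ℕ → ℂ) (n : ℕ) (x : ℂ) : ℂ :=
  (1 - b n * z n) * ((∏ i ∈ Finset.range n, (x - z i)) / poleProd b (n + 1) x)

/-- The error made when the Cauchy kernel `1 / (w - x)` is replaced by the first `n` terms of its
expansion in the functions `ratBasis b z` of `x`. -/
def kernelError (b z : ℕ → ℂ) (x : ℂ) (n : ℕ) (w : ℂ) : ℂ :=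
  (w - x)⁻¹ * ∏ i ∈ Finset.range n, ((x - z i) / (w - z i) * ((1 - b i * w) / (1 - b i * x)))

lemma dividedDiff_congr {z : ℕ → ℂ} {n : ℕ} {f g : ℂ → ℂ} (h : ∀ k, f (z k) = g (z k)) :
    dividedDiff z n f = dividedDiff z n g := by
  simp only [dividedDiff, h]

/-- `poleProd b n` as a polynomial. -/
def polePoly (b : ℕ → ℂ) (n : ℕ) : Polynomial ℂ :=
  ∏ i ∈ Finset.range n, (1 - Polynomial.C (b i) * Polynomial.X)

lemma eval_polePoly (b : ℕ → ℂ) (n : ℕ) (y : ℂ) : (polePoly b n).eval y = poleProd b n y := by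
  simp [polePoly, poleProd, Polynomial.eval_prod]

lemma degree_polePoly_lt (b : ℕ → ℂ) {m n : ℕ} (h : n < m) :
    (polePoly b n).degree < (Finset.range m).card := by
  have h1 : (polePoly b n).natDegree ≤ ∑ i ∈ Finset.range n, 1 :=
    (Polynomial.natDegree_prod_le _ _).trans (Finset.sum_le_sum fun i _ => by compute_degree)
  simp only [Finset.sum_const, Finset.card_range, smul_eq_mul, mul_one] at h1
  refine lt_of_le_of_lt Polynomial.degree_le_natDegree ?_
  rw [Finset.card_range]
  exact_mod_cast h1.trans_lt h

/-- The partial fraction decomposition of `poleProd b n w / ((w - z 0) ⋯ (w - z n))`: it is proper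
because `poleProd b n` has degree at most `n`. -/
lemma poleProd_div_prod_sub {b z : ℕ → ℂ} (hz : Function.Injective z) {w : ℂ}
    (hw : ∀ i, w ≠ z i) (n : ℕ) :
    poleProd b n w / ∏ i ∈ Finset.range (n + 1), (w - z i) =
      dividedDiff z n (fun y => poleProd b n y * (w - y)⁻¹) := by
  have h := Lagrange.eval_interpolate_not_at_node (s := Finset.range (n + 1)) (v := z)
    (fun i => (polePoly b n).eval (z i)) (x := w) (fun i _ => hw i)
  rw [← Lagrange.eq_interpolate hz.injOn (degree_polePoly_lt b n.lt_succ_self),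
    Lagrange.eval_nodal] at h
  have h0 : ∏ i ∈ Finset.range (n + 1), (w - z i) ≠ 0 :=
    Finset.prod_ne_zero_iff.2 fun i _ => sub_ne_zero.2 (hw i)
  rw [← eval_polePoly, h, mul_div_cancel_left₀ _ h0]
  refine Finset.sum_congr rfl fun k _ => ?_
  simp only [eval_polePoly]
  ring

/-- The terms of the expansion of the Cauchy kernel telescope. -/
lemma kernelError_sub_succ {b z : ℕ → ℂ} {x w : ℂ} (hwx : w ≠ x) (hw : ∀ i, w ≠ z i)
    (hb : ∀ i, 1 - b i * x ≠ 0) (n : ℕ) :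
    kernelError b z x n w - kernelError b z x (n + 1) w =
      ratBasis b z n x * (poleProd b n w / ∏ i ∈ Finset.range (n + 1), (w - z i)) := by
  have h0 : w - x ≠ 0 := sub_ne_zero.2 hwx
  have h1 : w - z n ≠ 0 := sub_ne_zero.2 (hw n)
  have h2 : 1 - x * b n ≠ 0 := mul_comm (b n) x ▸ hb n
  have h3 : ∏ i ∈ Finset.range n, (w - z i) ≠ 0 :=
    Finset.prod_ne_zero_iff.2 fun i _ => sub_ne_zero.2 (hw i)
  have h4 : ∏ i ∈ Finset.range n, (1 - b i * x) ≠ 0 :=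
    Finset.prod_ne_zero_iff.2 fun i _ => hb i
  simp only [kernelError, ratBasis, poleProd, Finset.prod_range_succ, Finset.prod_mul_distrib,
    Finset.prod_div_distrib, mul_comm (b n) x]
  generalize ∏ i ∈ Finset.range n, (w - z i) = p₁ at *
  generalize ∏ i ∈ Finset.range n, (1 - b i * x) = p₂ at *
  field_simp
  ring

lemma continuousOn_kernelError {b z : ℕ → ℂ} {x : ℂ} {s : Set ℂ} (hx : x ∉ s)
    (hs : ∀ w ∈ s, ∀ i, w ≠ z i) (n : ℕ) : ContinuousOn (kernelError b z x n) s := by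
  unfold kernelError
  refine ContinuousOn.mul (ContinuousOn.inv₀ (by fun_prop) ?_) (continuousOn_finsetProd _ ?_)
  · rintro w hw h
    exact hx (sub_eq_zero.1 h ▸ hw)
  · intro i _
    refine ContinuousOn.mul (ContinuousOn.div (by fun_prop) (by fun_prop) ?_) (by fun_prop)
    exact fun w hw => sub_ne_zero.2 (hs w hw i)

/-- If `‖x‖ < s ≤ ‖w‖` on a bounded set of points `w`, the factors of `kernelError` are eventually
bounded by a constant less than `1`, because they tend to `x / w` uniformly in `w`. -/
lemma exists_eventually_norm_factor_le {b z : ℕ → ℂ} (hz0 : Tendsto z atTop (𝓝 0))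
    (hb0 : Tendsto b atTop (𝓝 0)) {x : ℂ} {s L : ℝ} (hs : ‖x‖ < s) :
    ∃ θ : ℝ, 0 ≤ θ ∧ θ < 1 ∧ ∀ᶠ n in atTop, ∀ w : ℂ, s ≤ ‖w‖ → ‖w‖ ≤ L →
      ‖(x - z n) / (w - z n) * ((1 - b n * w) / (1 - b n * x))‖ ≤ θ := by
  have hs0 : 0 < s := (norm_nonneg x).trans_lt hs
  have hz : Tendsto (fun n => ‖z n‖) atTop (𝓝 0) := by simpa using hz0.norm
  have hb : Tendsto (fun n => ‖b n‖) atTop (𝓝 0) := by simpa using hb0.norm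
  have hlim : Tendsto (fun n => (‖x‖ + ‖z n‖) / (s - ‖z n‖) *
      ((1 + ‖b n‖ * L) / (1 - ‖b n‖ * ‖x‖))) atTop (𝓝 (‖x‖ / s)) := by
    have := ((hz.const_add ‖x‖).div (hz.const_sub s) (by simpa using hs0.ne')).mul
      (((hb.mul_const L).const_add 1).div ((hb.mul_const ‖x‖).const_sub 1) (by simp))
    simpa using this
  obtain ⟨θ, h1, h2⟩ := exists_between ((div_lt_one hs0).2 hs)
  refine ⟨θ, (div_nonneg (norm_nonneg x) hs0.le).trans h1.le, h2, ?_⟩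
  have hb1 : ∀ᶠ n in atTop, ‖b n‖ * ‖x‖ < 1 := by
    have := hb.mul_const ‖x‖
    rw [zero_mul] at this
    exact this.eventually (gt_mem_nhds one_pos)
  filter_upwards [hlim.eventually (gt_mem_nhds h1), hz.eventually (gt_mem_nhds hs0), hb1]
    with n hn hzn hbn w hw hwL
  refine le_trans ?_ hn.le
  rw [norm_mul, norm_div, norm_div]
  have e1 : ‖x - z n‖ ≤ ‖x‖ + ‖z n‖ := norm_sub_le _ _
  have e2 : s - ‖z n‖ ≤ ‖w - z n‖ := by
    have := norm_sub_norm_le w (z n)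
    linarith
  have e3 : ‖1 - b n * w‖ ≤ 1 + ‖b n‖ * L := by
    refine (norm_sub_le _ _).trans ?_
    rw [norm_one, norm_mul]
    gcongr
  have e4 : 1 - ‖b n‖ * ‖x‖ ≤ ‖1 - b n * x‖ := by
    have := norm_sub_norm_le 1 (b n * x)
    rwa [norm_one, norm_mul] at this
  have e5 : 0 < s - ‖z n‖ := by linarith
  have e6 : 0 < 1 - ‖b n‖ * ‖x‖ := by linarith
  have e7 : 0 ≤ 1 + ‖b n‖ * L := (norm_nonneg _).trans e3
  gcongr

/-- The expansion of the Cauchy kernel, integrated against a density `φ` over a circle all of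
whose points have absolute value larger than `‖x‖`. -/
theorem hasSum_circleIntegral_kernel {b z : ℕ → ℂ} (hz0 : Tendsto z atTop (𝓝 0))
    (hb0 : Tendsto b atTop (𝓝 0)) {x : ℂ} (hb : ∀ i, 1 - b i * x ≠ 0) {c : ℂ} {ρ s : ℝ}
    (hρ : 0 ≤ ρ) (hs : ‖x‖ < s) (hsw : ∀ w ∈ Metric.sphere c ρ, s ≤ ‖w‖)
    (hw : ∀ w ∈ Metric.sphere c ρ, ∀ i, w ≠ z i) {φ : ℂ → ℂ}
    (hφ : ContinuousOn φ (Metric.sphere c ρ)) :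
    HasSum (fun n => ratBasis b z n x *
      ∮ w in C(c, ρ), φ w * (poleProd b n w / ∏ i ∈ Finset.range (n + 1), (w - z i)))
      (∮ w in C(c, ρ), φ w * (w - x)⁻¹) := by
  have hxs : x ∉ Metric.sphere c ρ := fun h => (hsw x h).not_gt hs
  have hcont : ∀ n, ContinuousOn (fun w => φ w * kernelError b z x n w) (Metric.sphere c ρ) :=
    fun n => hφ.mul (continuousOn_kernelError hxs hw n)
  set E : ℕ → ℂ := fun n => ∮ w in C(c, ρ), φ w * kernelError b z x n w with hE
  have hstep : ∀ n, ratBasis b z n x * (∮ w in C(c, ρ), φ w *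
      (poleProd b n w / ∏ i ∈ Finset.range (n + 1), (w - z i))) = E n - E (n + 1) := by
    intro n
    rw [hE, ← circleIntegral.integral_const_mul, ← circleIntegral.integral_sub
      ((hcont n).circleIntegrable hρ) ((hcont (n + 1)).circleIntegrable hρ)]
    refine circleIntegral.integral_congr hρ fun w hws => ?_
    have := kernelError_sub_succ (ne_of_mem_of_not_mem hws hxs) (hw w hws) hb n
    rw [← mul_sub, this, mul_left_comm]
  have hE0 : (∮ w in C(c, ρ), φ w * (w - x)⁻¹) = E 0 := by simp [hE, kernelError]
  obtain ⟨θ, hθ0, hθ1, hθ⟩ :=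
    exists_eventually_norm_factor_le (L := ‖c‖ + ρ) hz0 hb0 hs
  obtain ⟨N, hN⟩ := eventually_atTop.1 hθ
  obtain ⟨B, hB⟩ := (isCompact_sphere c ρ).exists_bound_of_continuousOn (hcont N)
  have hbound : ∀ j, ∀ w ∈ Metric.sphere c ρ,
      ‖φ w * kernelError b z x (j + N) w‖ ≤ B * θ ^ j := by
    intro j w hws
    induction j with
    | zero => simpa using hB w hws
    | succ j ih =>
      have hwL : ‖w‖ ≤ ‖c‖ + ρ := by
        have h1 : ‖w - c‖ = ρ := by simpa [dist_eq_norm] using hws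
        calc ‖w‖ = ‖c + (w - c)‖ := by congr 1; ring
          _ ≤ ‖c‖ + ‖w - c‖ := norm_add_le _ _
          _ = _ := by rw [h1]
      have h2 := hN (j + N) (by omega) w (hsw w hws) hwL
      have h3 : φ w * kernelError b z x (j + 1 + N) w = φ w * kernelError b z x (j + N) w *
          ((x - z (j + N)) / (w - z (j + N)) *
            ((1 - b (j + N) * w) / (1 - b (j + N) * x))) := by
        rw [show j + 1 + N = j + N + 1 by ring]
        simp only [kernelError, Finset.prod_range_succ]
        ring
      rw [h3, norm_mul, pow_succ, ← mul_assoc]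
      exact mul_le_mul ih h2 (norm_nonneg _) ((norm_nonneg _).trans ih)
  have hsumE : Summable E := by
    rw [← summable_nat_add_iff N]
    refine Summable.of_norm_bounded
      (((summable_geometric_of_lt_one hθ0 hθ1).mul_left (2 * Real.pi * ρ * B))) fun j => ?_
    refine (circleIntegral.norm_integral_le_of_norm_le_const hρ (hbound j)).trans (le_of_eq ?_)
    ring
  simp only [hstep, hE0]
  have hsum : Summable fun n => E n - E (n + 1) := hsumE.sub ((summable_nat_add_iff 1).2 hsumE)
  rw [hsum.hasSum_iff_tendsto_nat]
  simp only [Finset.sum_range_sub']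
  simpa using hsumE.tendsto_atTop_zero.const_sub (E 0)

/-- By partial fractions, divided differences of Cauchy integrals are contour integrals. -/
lemma dividedDiff_cauchyIntegral {b z : ℕ → ℂ} (hz : Function.Injective z) {c : ℂ} {ρ : ℝ}
    (hρ : 0 ≤ ρ) (hw : ∀ w ∈ Metric.sphere c ρ, ∀ i, w ≠ z i) {φ : ℂ → ℂ}
    (hφ : ContinuousOn φ (Metric.sphere c ρ)) (n : ℕ) :
    dividedDiff z n (fun y => poleProd b n y * ∮ w in C(c, ρ), φ w * (w - y)⁻¹) =
      ∮ w in C(c, ρ), φ w * (poleProd b n w / ∏ i ∈ Finset.range (n + 1), (w - z i)) := by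
  have hint : ∀ i, CircleIntegrable (fun w => φ w * (w - z i)⁻¹) c ρ := fun i =>
    (hφ.mul (ContinuousOn.inv₀ (by fun_prop)
      fun w hws => sub_ne_zero.2 (hw w hws i))).circleIntegrable hρ
  rw [circleIntegral.integral_congr hρ (g := fun w => ∑ k ∈ Finset.range (n + 1),
    (Lagrange.nodalWeight (Finset.range (n + 1)) z k * poleProd b n (z k)) *
      (φ w * (w - z k)⁻¹)), circleIntegral.integral_fun_sum]
  · simp only [circleIntegral.integral_const_mul, dividedDiff, mul_assoc]
  · exact fun i _ => (hint i).const_smul (a := _)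
  · intro w hws
    simp only
    rw [poleProd_div_prod_sub hz (hw w hws), dividedDiff, Finset.mul_sum]
    refine Finset.sum_congr rfl fun k _ => ?_
    ring

/-- The expansion of a Cauchy integral, with divided differences as coefficients. -/
theorem hasSum_dividedDiff_cauchyIntegral {b z : ℕ → ℂ} (hz : Function.Injective z)
    (hz0 : Tendsto z atTop (𝓝 0)) (hb0 : Tendsto b atTop (𝓝 0)) {x : ℂ}
    (hb : ∀ i, 1 - b i * x ≠ 0) {c : ℂ} {ρ s : ℝ}
    (hρ : 0 ≤ ρ) (hs : ‖x‖ < s) (hsw : ∀ w ∈ Metric.sphere c ρ, s ≤ ‖w‖)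
    (hw : ∀ w ∈ Metric.sphere c ρ, ∀ i, w ≠ z i) {φ : ℂ → ℂ}
    (hφ : ContinuousOn φ (Metric.sphere c ρ)) :
    HasSum (fun n => ratBasis b z n x * dividedDiff z n
        (fun y => poleProd b n y * ∮ w in C(c, ρ), φ w * (w - y)⁻¹))
      (∮ w in C(c, ρ), φ w * (w - x)⁻¹) := by
  simp only [dividedDiff_cauchyIntegral hz hρ hw hφ]
  exact hasSum_circleIntegral_kernel hz0 hb0 hb hρ hs hsw hw hφ

/-- The value at a node `z k` farther from the origin than `x` does not affect the sum of the
expansion at `x`: the function that is `1` at `z k` and `0` at the other nodes is a Cauchy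
integral over a small circle around `z k`, and that integral vanishes at `x`. -/
lemma hasSum_dividedDiff_single {b z : ℕ → ℂ} (hz : Function.Injective z)
    (hz0 : Tendsto z atTop (𝓝 0)) (hb0 : Tendsto b atTop (𝓝 0)) {x : ℂ}
    (hb : ∀ i, 1 - b i * x ≠ 0) {k : ℕ} (hk : ‖x‖ < ‖z k‖) :
    HasSum (fun n => ratBasis b z n x * dividedDiff z n
      (fun y => poleProd b n y * if y = z k then 1 else 0)) 0 := by
  have hzk : z k ≠ 0 := norm_pos_iff.1 ((norm_nonneg x).trans_lt hk)
  have hlim : Tendsto (fun i => if i = k then 0 else z i) atTop (𝓝 0) := by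
    refine hz0.congr' ?_
    filter_upwards [eventually_gt_atTop k] with i hi
    rw [if_neg hi.ne']
  have hclosed := hlim.isCompact_insert_range.isClosed
  have hmem : z k ∉ insert 0 (Set.range fun i => if i = k then 0 else z i) := by
    rintro (h | ⟨i, h⟩)
    · exact hzk h
    · by_cases hi : i = k
      · simp only [if_pos hi] at h
        exact hzk h.symm
      · simp only [if_neg hi] at h
        exact hi (hz h)
  obtain ⟨ε, hε, hball⟩ := Metric.isOpen_iff.1 hclosed.isOpen_compl _ hmem
  obtain ⟨ρ, hρ0, hρ⟩ := exists_between (lt_min hε (half_pos (sub_pos.2 hk)))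
  have hρε := hρ.trans_le (min_le_left _ _)
  have hρx := hρ.trans_le (min_le_right _ _)
  have hfar : ∀ i, i ≠ k → z i ∉ Metric.closedBall (z k) ρ := by
    intro i hi h
    refine hball (Metric.closedBall_subset_ball hρε h) (Or.inr ⟨i, ?_⟩)
    simp only [if_neg hi]
  have hnorm : ∀ w ∈ Metric.closedBall (z k) ρ, (‖x‖ + ‖z k‖) / 2 ≤ ‖w‖ := by
    intro w hw
    have h1 : ‖z k - w‖ ≤ ρ := by rw [← dist_eq_norm, dist_comm]; exact hw
    have h2 := norm_sub_norm_le (z k) w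
    linarith
  have hx : x ∉ Metric.closedBall (z k) ρ := fun h => by
    have := hnorm x h
    linarith
  -- outside the closed disc the Cauchy integral vanishes by Cauchy's theorem
  have hout : ∀ y, y ∉ Metric.closedBall (z k) ρ →
      (∮ w in C(z k, ρ), (2 * Real.pi * Complex.I)⁻¹ * (w - y)⁻¹) = 0 := by
    intro y hy
    have hd : DifferentiableOn ℂ (fun w => (2 * Real.pi * Complex.I : ℂ)⁻¹ * (w - y)⁻¹)
        (Metric.closedBall (z k) ρ) :=
      DifferentiableOn.const_mul (DifferentiableOn.inv (by fun_prop)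
        fun w hw => sub_ne_zero.2 (ne_of_mem_of_not_mem hw hy)) _
    refine DiffContOnCl.circleIntegral_eq_zero hρ0.le (DifferentiableOn.diffContOnCl ?_)
    rwa [closure_ball _ hρ0.ne']
  have hin : (∮ w in C(z k, ρ), (2 * Real.pi * Complex.I : ℂ)⁻¹ * (w - z k)⁻¹) = 1 := by
    rw [circleIntegral.integral_const_mul,
      circleIntegral.integral_sub_inv_of_mem_ball (Metric.mem_ball_self hρ0)]
    exact inv_mul_cancel₀ Complex.two_pi_I_ne_zero
  have hs : ‖x‖ < (‖x‖ + ‖z k‖) / 2 := by linarith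
  have key := hasSum_dividedDiff_cauchyIntegral hz hz0 hb0 hb hρ0.le hs
    (fun w hw => hnorm w (Metric.sphere_subset_closedBall hw))
    (fun w hw i h => by
      by_cases hi : i = k
      · rw [h, hi, Metric.mem_sphere, dist_self] at hw
        exact hρ0.ne hw
      · exact hfar i hi (h ▸ Metric.sphere_subset_closedBall hw))
    (φ := fun _ => (2 * Real.pi * Complex.I : ℂ)⁻¹) continuousOn_const
  rw [hout x hx] at key
  convert key using 3 with n
  refine dividedDiff_congr fun i => ?_
  by_cases hi : i = k
  · rw [hi, hin, if_pos rfl]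
  · rw [hout _ (hfar i hi), if_neg (fun h => hi (hz h))]

/-- A function `F` that is holomorphic in the disc of radius `R` has the expansion
`F x = ∑ ratBasis b z n x * (F (1 - b 0 ·) ⋯ (1 - b (n-1) ·))[z 0, …, z n]` at the points `x` of
the disc, whatever the values of `F` are at the nodes outside of the disc. -/
theorem hasSum_dividedDiff {b z : ℕ → ℂ} (hz : Function.Injective z)
    (hz0 : Tendsto z atTop (𝓝 0)) (hb0 : Tendsto b atTop (𝓝 0)) {x : ℂ}
    (hb : ∀ i, 1 - b i * x ≠ 0) {R : ℝ} {F : ℂ → ℂ}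
    (hF : DifferentiableOn ℂ F (Metric.ball 0 R)) (hx : ‖x‖ < R) :
    HasSum (fun n => ratBasis b z n x * dividedDiff z n (fun y => poleProd b n y * F y))
      (F x) := by
  -- a circle about the origin that separates `x` from the boundary and avoids all nodes
  obtain ⟨r, hr, hxr, hrR⟩ :=
    ((Set.countable_range fun i => ‖z i‖).dense_compl ℝ).exists_between hx
  have hr0 : 0 < r := (norm_nonneg x).trans_lt hxr
  have hrz : ∀ i, ‖z i‖ ≠ r := fun i h => hr ⟨i, h⟩
  have hFr : DifferentiableOn ℂ F (Metric.closedBall 0 r) :=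
    hF.mono (Metric.closedBall_subset_ball hrR)
  have hnorm : ∀ w ∈ Metric.sphere (0 : ℂ) r, ‖w‖ = r := fun w hw => by simpa using hw
  set F₀ : ℂ → ℂ := fun y =>
    ∮ w in C(0, r), ((2 * Real.pi * Complex.I : ℂ)⁻¹ * F w) * (w - y)⁻¹ with hF₀
  have hcauchy : ∀ y ∈ Metric.ball (0 : ℂ) r, F₀ y = F y := by
    intro y hy
    have h := DiffContOnCl.two_pi_i_inv_smul_circleIntegral_sub_inv_smul
      (DifferentiableOn.diffContOnCl (by rwa [closure_ball _ hr0.ne'])) hy (f := F)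
    rw [← h, hF₀, smul_eq_mul, ← circleIntegral.integral_const_mul]
    simp only [smul_eq_mul]
    congr 1
    ext w
    ring
  have h0 := hasSum_dividedDiff_cauchyIntegral hz hz0 hb0 hb hr0.le hxr
    (fun w hw => (hnorm w hw).ge) (fun w hw i h => hrz i (h ▸ hnorm w hw))
    (φ := fun w => (2 * Real.pi * Complex.I : ℂ)⁻¹ * F w)
    (continuousOn_const.mul (hFr.continuousOn.mono Metric.sphere_subset_closedBall))
  have hfin : {k | r < ‖z k‖}.Finite := by
    have h1 : Tendsto (fun n => ‖z n‖) atTop (𝓝 0) := by simpa using hz0.norm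
    have h2 := h1.eventually (gt_mem_nhds hr0)
    rw [← Nat.cofinite_eq_atTop, eventually_cofinite] at h2
    exact h2.subset fun k hk => not_lt.2 (le_of_lt hk)
  set K := hfin.toFinset with hK
  have h1 := h0.add (hasSum_sum (s := K) fun k hk =>
    (hasSum_dividedDiff_single hz hz0 hb0 hb
      (hxr.trans (hfin.mem_toFinset.1 hk))).mul_left (F (z k) - F₀ (z k)))
  change HasSum _ (F₀ x + _) at h1
  rw [hcauchy x (by simpa using hxr)] at h1
  simp only [mul_zero, Finset.sum_const_zero, add_zero] at h1
  convert h1 using 2 with n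
  have hsplit : ∀ i, F (z i) =
      F₀ (z i) + ∑ k ∈ K, (F (z k) - F₀ (z k)) * if z i = z k then 1 else 0 := by
    intro i
    simp only [hz.eq_iff, mul_ite, mul_one, mul_zero, Finset.sum_ite_eq]
    split_ifs with hi
    · ring
    · rw [hK, hfin.mem_toFinset, Set.mem_ofPred_eq, not_lt] at hi
      rw [hcauchy _ (by simpa using lt_of_le_of_ne hi (hrz i)), add_zero]
  have hlin : dividedDiff z n (fun y => poleProd b n y * F y) =
      dividedDiff z n (fun y => poleProd b n y * F₀ y) + ∑ k ∈ K, (F (z k) - F₀ (z k)) *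
        dividedDiff z n (fun y => poleProd b n y * if y = z k then 1 else 0) := by
    simp only [dividedDiff, Finset.mul_sum]
    rw [Finset.sum_comm, ← Finset.sum_add_distrib]
    refine Finset.sum_congr rfl fun i _ => ?_
    rw [hsplit i, mul_add, mul_add, Finset.mul_sum, Finset.mul_sum]
    congr 1
    refine Finset.sum_congr rfl fun k _ => ?_
    ring
  rw [hlin, mul_add, Finset.mul_sum]
  congr 1
  refine Finset.sum_congr rfl fun k _ => ?_
  ring

/-! ### Divided differences -/

/-- Divided differences of order `n + 1` annihilate polynomials of degree at most `n`. -/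
lemma dividedDiff_poleProd {z : ℕ → ℂ} (hz : Function.Injective z) (b : ℕ → ℂ) (n : ℕ) :
    dividedDiff z (n + 1) (poleProd b n) = 0 := by
  have h := Lagrange.coeff_eq_sum (s := Finset.range (n + 1 + 1)) (v := z) hz.injOn
    (degree_polePoly_lt b (by omega : n < n + 1 + 1))
  rw [Polynomial.coeff_eq_zero_of_degree_lt (by
    simpa using degree_polePoly_lt b n.lt_succ_self)] at h
  rw [h, dividedDiff]
  refine Finset.sum_congr rfl fun k _ => ?_
  rw [eval_polePoly, Lagrange.nodalWeight, Finset.prod_inv_distrib]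
  ring

lemma nodalWeight_range (z : ℕ → ℂ) (n k : ℕ) :
    Lagrange.nodalWeight (Finset.range n) z k =
      ∏ j ∈ Finset.range n, if j = k then 1 else (z k - z j)⁻¹ := by
  rw [Lagrange.nodalWeight, ← Finset.prod_erase (Finset.range n)
    (f := fun j => if j = k then 1 else (z k - z j)⁻¹) (a := k) (if_pos rfl)]
  refine Finset.prod_congr rfl fun j hj => ?_
  rw [if_neg (Finset.ne_of_mem_erase hj)]

/-- The recursion that defines divided differences classically. -/
lemma dividedDiff_succ {z : ℕ → ℂ} (hz : Function.Injective z) (g : ℂ → ℂ) (n : ℕ) :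
    dividedDiff z (n + 1) g * (z 0 - z (n + 1)) =
      dividedDiff z n g - dividedDiff (fun i => z (i + 1)) n g := by
  have hne : ∀ {i j}, i ≠ j → z i - z j ≠ 0 := fun h => sub_ne_zero.2 (hz.ne h)
  have h1 : dividedDiff z n g = ∑ k ∈ Finset.range (n + 2),
      Lagrange.nodalWeight (Finset.range (n + 2)) z k * (z k - z (n + 1)) * g (z k) := by
    rw [Finset.sum_range_succ, sub_self, mul_zero, zero_mul, add_zero]
    refine Finset.sum_congr rfl fun k hk => ?_
    have hk' : n + 1 ≠ k := (Finset.mem_range.1 hk).ne'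
    rw [nodalWeight_range, nodalWeight_range, Finset.prod_range_succ _ (n + 1), if_neg hk',
      mul_assoc _ (z k - z (n + 1))⁻¹, inv_mul_cancel₀ (hne hk'.symm), mul_one]
  have h2 : dividedDiff (fun i => z (i + 1)) n g = ∑ k ∈ Finset.range (n + 2),
      Lagrange.nodalWeight (Finset.range (n + 2)) z k * (z k - z 0) * g (z k) := by
    rw [Finset.sum_range_succ', sub_self, mul_zero, zero_mul, add_zero]
    refine Finset.sum_congr rfl fun k _ => ?_
    rw [nodalWeight_range, nodalWeight_range, Finset.prod_range_succ' _ (n + 1),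
      if_neg (Nat.succ_ne_zero k).symm, mul_assoc _ (z (k + 1) - z 0)⁻¹,
      inv_mul_cancel₀ (hne (Nat.succ_ne_zero k)), mul_one]
    simp only [add_left_inj]
  rw [h1, h2, dividedDiff, Finset.sum_mul, ← Finset.sum_sub_distrib]
  refine Finset.sum_congr rfl fun k _ => ?_
  ring

/-! ### `q`-shifted factorials -/

lemma qPoch_natCast (a q : ℂ) (n : ℕ) :
    qPoch a q n = ∏ i ∈ Finset.range n, (1 - a * q ^ i) := rfl

lemma qPoch_zero (a q : ℂ) : qPoch a q 0 = 1 := rfl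

lemma qPoch_neg_one (a q : ℂ) : qPoch a q (-1) = (1 - a * q⁻¹)⁻¹ := by
  change (∏ i ∈ Finset.range (0 + 1), (1 - a * (q⁻¹) ^ (i + 1)))⁻¹ = _
  simp

lemma qPoch_self_negSucc {q : ℂ} (hq0 : q ≠ 0) (n : ℕ) : qPoch q q (Int.negSucc n) = 0 := by
  change (∏ i ∈ Finset.range (n + 1), (1 - q * (q⁻¹) ^ (i + 1)))⁻¹ = 0
  rw [Finset.prod_range_succ']
  simp [hq0]

lemma qPoch_self_sub_of_lt {q : ℂ} (hq0 : q ≠ 0) {n k : ℕ} (h : n < k) :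
    qPoch q q ((n : ℤ) - k) = 0 := by
  obtain ⟨d, rfl⟩ := Nat.exists_eq_add_of_lt h
  rw [show (n : ℤ) - ((n + d + 1 : ℕ) : ℤ) = Int.negSucc d by push_cast; omega]
  exact qPoch_self_negSucc hq0 d

lemma one_sub_pow_succ_ne_zero {q : ℂ} (hq : ‖q‖ < 1) (n : ℕ) : 1 - q ^ (n + 1) ≠ 0 := by
  intro h
  have h1 : ‖q ^ (n + 1)‖ = 1 := by rw [← sub_eq_zero.1 h, norm_one]
  rw [norm_pow] at h1
  exact (pow_lt_one₀ (norm_nonneg q) hq n.succ_ne_zero).ne h1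

lemma qPoch_self_ne_zero {q : ℂ} (hq : ‖q‖ < 1) (n : ℕ) : qPoch q q n ≠ 0 := by
  rw [qPoch_natCast, Finset.prod_ne_zero_iff]
  intro i _
  rw [← pow_succ']
  exact one_sub_pow_succ_ne_zero hq i

lemma injective_mul_pow {q c : ℂ} (hq0 : q ≠ 0) (hq : ‖q‖ < 1) (hc : c ≠ 0) :
    Function.Injective fun i : ℕ => c * q ^ i := by
  intro i j h
  have h1 : ‖q‖ ^ i = ‖q‖ ^ j := by
    rw [← norm_pow, ← norm_pow, mul_left_cancel₀ hc h]
  exact (pow_right_strictAnti₀ (norm_pos_iff.2 hq0) hq).injective h1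

lemma tendsto_mul_pow_zero {q : ℂ} (hq : ‖q‖ < 1) (c : ℂ) :
    Tendsto (fun i : ℕ => c * q ^ i) atTop (𝓝 0) := by
  simpa using (tendsto_pow_atTop_nhds_zero_of_norm_lt_one hq).const_mul c

lemma prod_mul_pow_sub_lower (c q : ℂ) (k : ℕ) :
    ∏ j ∈ Finset.range k, (c * q ^ k - c * q ^ j) =
      c ^ k * (-1) ^ k * q ^ k.choose 2 * qPoch q q k := by
  induction k with
  | zero => simp [qPoch_zero]
  | succ k ih =>
    have h : ∀ j ∈ Finset.range k, c * q ^ (k + 1) - c * q ^ (j + 1) =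
        q * (c * q ^ k - c * q ^ j) := fun j _ => by ring
    rw [Finset.prod_range_succ', Finset.prod_congr rfl h, Finset.prod_mul_distrib, ih,
      Finset.prod_const, Finset.card_range, qPoch_natCast, qPoch_natCast,
      Finset.prod_range_succ, Nat.choose_succ_succ' k 1, Nat.choose_one_right]
    ring

lemma prod_mul_pow_sub_upper (c q : ℂ) (k l : ℕ) :
    ∏ j ∈ Finset.range l, (c * q ^ k - c * q ^ (k + 1 + j)) =
      c ^ l * q ^ (k * l) * qPoch q q l := by
  have h : ∀ j ∈ Finset.range l, c * q ^ k - c * q ^ (k + 1 + j) =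
      c * q ^ k * (1 - q * q ^ j) := fun j _ => by ring
  rw [Finset.prod_congr rfl h, Finset.prod_mul_distrib, Finset.prod_const, Finset.card_range,
    qPoch_natCast, mul_pow, ← pow_mul]

/-- The weights of the divided differences at geometric nodes are, up to a factor independent of
`k`, the signed `q`-binomial coefficients. -/
lemma nodalWeight_mul_pow (c q : ℂ) (k l : ℕ) :
    Lagrange.nodalWeight (Finset.range (k + l + 1)) (fun i => c * q ^ i) k =
      (c ^ (k + l))⁻¹ * ((-1) ^ k * q ^ (((k + 1).choose 2 : ℤ) - (k + l) * k)) /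
        (qPoch q q k * qPoch q q l) := by
  have h1 : (c ^ (k + l) * (-1) ^ k * q ^ (k.choose 2 + k * l) * (qPoch q q k * qPoch q q l)) =
      ∏ j ∈ Finset.range (k + l + 1), if j = k then 1 else (c * q ^ k - c * q ^ j) := by
    rw [show k + l + 1 = k + 1 + l by ring, Finset.prod_range_add, Finset.prod_range_succ,
      if_pos rfl, mul_one]
    rw [Finset.prod_congr rfl fun j hj => if_neg (Finset.mem_range.1 hj).ne,
      Finset.prod_congr rfl fun j _ => if_neg (show k + 1 + j ≠ k by omega),
      prod_mul_pow_sub_lower, prod_mul_pow_sub_upper]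
    ring
  have h2 : Lagrange.nodalWeight (Finset.range (k + l + 1)) (fun i => c * q ^ i) k =
      (∏ j ∈ Finset.range (k + l + 1), if j = k then 1 else (c * q ^ k - c * q ^ j))⁻¹ := by
    rw [nodalWeight_range, ← Finset.prod_inv_distrib]
    refine Finset.prod_congr rfl fun j _ => ?_
    split_ifs <;> simp
  have h3 : ((k + 1).choose 2 : ℤ) - (k + l) * k = -((k.choose 2 + k * l : ℕ) : ℤ) := by
    have h4 : k.choose 2 * 2 + k = k * k := by
      clear h1 h2
      induction k with
      | zero => rfl
      | succ k ih =>
        rw [Nat.choose_succ_succ' k 1, Nat.choose_one_right]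
        linarith
    have h5 : (k.choose 2 : ℤ) * 2 + k = k * k := by exact_mod_cast h4
    rw [Nat.choose_succ_succ' k 1, Nat.choose_one_right]
    push_cast
    linarith
  have h6 : ((-1 : ℂ) ^ k)⁻¹ = (-1) ^ k := by rw [← inv_pow, inv_neg_one]
  rw [h2, ← h1, h3, zpow_neg, zpow_natCast]
  simp only [mul_inv, h6]
  ring

/-- The divided difference at the nodes `c, cq, …, cq^n` as a `q`-binomial sum. -/
lemma qPoch_mul_dividedDiff (c q : ℂ) (n : ℕ) (g : ℂ → ℂ) :
    qPoch q q n * dividedDiff (fun i => c * q ^ i) n g =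
      (c ^ n)⁻¹ * ∑ k ∈ Finset.range (n + 1),
        (-1) ^ k * q ^ (((k + 1).choose 2 : ℤ) - n * k) * qBinom q n k * g (c * q ^ k) := by
  rw [dividedDiff, Finset.mul_sum, Finset.mul_sum]
  refine Finset.sum_congr rfl fun k hk => ?_
  obtain ⟨l, rfl⟩ := Nat.exists_eq_add_of_le (Nat.lt_succ_iff.1 (Finset.mem_range.1 hk))
  rw [nodalWeight_mul_pow, qBinom,
    show (((k + l : ℕ) : ℤ) - k) = (l : ℤ) by push_cast; ring]
  push_cast
  ring

/-- The iterated `q`-difference operator is a divided difference at the points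
`x, xq, …, xq^n`. -/
lemma iterate_qDiff {q : ℂ} (hq0 : q ≠ 0) (hq : ‖q‖ < 1) (g : ℂ → ℂ) (n : ℕ) :
    ∀ x : ℂ, x ≠ 0 →
      (qDiff q)^[n] g x = qPoch q q n * dividedDiff (fun i => x * q ^ i) n g := by
  induction n with
  | zero =>
    intro x _
    simp [dividedDiff, qPoch_zero, Lagrange.nodalWeight]
  | succ n ih =>
    intro x hx
    have h := dividedDiff_succ (injective_mul_pow hq0 hq hx) g n
    have e1 : (fun i => x * q ^ (i + 1)) = fun i : ℕ => q * x * q ^ i := by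
      ext i
      ring
    have e2 : qPoch q q ((n + 1 : ℕ) : ℤ) = qPoch q q n * (1 - q ^ (n + 1)) := by
      rw [qPoch_natCast, qPoch_natCast, Finset.prod_range_succ, ← pow_succ']
    rw [e1] at h
    rw [Function.iterate_succ_apply', qDiff, ih x hx, ih (q * x) (mul_ne_zero hq0 hx),
      ← mul_sub, ← h, e2, pow_zero, mul_one]
    field_simp

/-! ### The Gessel--Stanton inverse pair -/

lemma gsMatrix_eq_zero {q : ℂ} (hq0 : q ≠ 0) (p A : ℂ) {n k : ℕ} (h : n < k) :
    gsMatrix p q A n k = 0 := by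
  rw [gsMatrix, qPoch_self_sub_of_lt hq0 h, div_zero, zero_mul]

lemma gsMatrixInv_eq_zero {q : ℂ} (hq0 : q ≠ 0) (p A : ℂ) {n k : ℕ} (h : n < k) :
    gsMatrixInv p q A n k = 0 := by
  rw [gsMatrixInv, qPoch_self_sub_of_lt hq0 h, div_zero, mul_zero]

/-- The `p`-shifted factorials in the entries `(k + m + 1, k + l)` of the matrix and `(k + l, k)`
of its inverse combine to a polynomial in `q ^ (k + l)` of degree `m`, independent of `l`. -/
lemma qPoch_mul_qPoch_inv {p q A : ℂ} (hp0 : p ≠ 0) (hA : ∀ k : ℕ, A * p ^ k * q ^ k ≠ 1)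
    (k l m : ℕ) (hl : l ≤ m + 1) :
    qPoch (A * p ^ (k + l) * q ^ (k + l)) p ((m + 1 - l : ℕ) : ℤ) *
        qPoch (A * q ^ (k + l) * p ^ (((k + l : ℕ) : ℤ) - 1)) p⁻¹ ((l : ℤ) - 1) =
      poleProd (fun i => A * p ^ (k + 1 + i)) m (q ^ k * q ^ l) := by
  rcases l with _ | l
  · have h0 : 1 - A * p ^ k * q ^ k ≠ 0 := sub_ne_zero.2 (hA k).symm
    have h1 : A * q ^ k * p ^ ((k : ℤ) - 1) * p = A * p ^ k * q ^ k := by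
      rw [zpow_sub_one₀ hp0, zpow_natCast]
      field_simp
    rw [qPoch_natCast, Nat.sub_zero, Finset.prod_range_succ']
    simp only [add_zero, Nat.cast_zero, zero_sub, qPoch_neg_one, inv_inv, h1, pow_zero, mul_one]
    rw [mul_assoc, mul_inv_cancel₀ h0, mul_one, poleProd]
    refine Finset.prod_congr rfl fun i _ => ?_
    ring
  · obtain ⟨d, rfl⟩ := Nat.exists_eq_add_of_le (Nat.succ_le_succ_iff.1 hl)
    rw [show l + d + 1 - (l + 1) = d by omega,
      show ((l + 1 : ℕ) : ℤ) - 1 = (l : ℤ) by push_cast; ring,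
      show ((k + (l + 1) : ℕ) : ℤ) - 1 = ((k + l : ℕ) : ℤ) by push_cast; ring, zpow_natCast,
      qPoch_natCast, qPoch_natCast, poleProd, Finset.prod_range_add, mul_comm,
      ← Finset.prod_range_reflect]
    congr 1
    · refine Finset.prod_congr rfl fun i hi => ?_
      obtain ⟨e, rfl⟩ := Nat.exists_eq_add_of_lt (Finset.mem_range.1 hi)
      rw [show i + e + 1 - 1 - i = e by omega, inv_pow,
        show k + (i + e + 1) = k + 1 + i + e by ring, pow_add p (k + 1 + i) e]
      field_simp
      ring
    · refine Finset.prod_congr rfl fun i _ => ?_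
      ring

/-- The matrix product vanishes off the diagonal because its entries are divided differences of
order `m + 1` of polynomials of degree at most `m`. -/
lemma sum_gsMatrix_mul_gsMatrixInv {p q A : ℂ} (hp0 : p ≠ 0) (hq0 : q ≠ 0) (hq : ‖q‖ < 1)
    (hA : ∀ k : ℕ, A * p ^ k * q ^ k ≠ 1) {n N : ℕ} (hn : n < N) (k : ℕ) :
    ∑ j ∈ Finset.range N, gsMatrix p q A n j * gsMatrixInv p q A j k =
      if n = k then 1 else 0 := by
  rcases lt_or_ge n k with hnk | hnk
  · rw [if_neg hnk.ne]
    refine Finset.sum_eq_zero fun j _ => ?_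
    rcases lt_or_ge n j with hj | hj
    · rw [gsMatrix_eq_zero hq0 p A hj, zero_mul]
    · rw [gsMatrixInv_eq_zero hq0 p A (hj.trans_lt hnk), mul_zero]
  obtain ⟨m, rfl⟩ := Nat.exists_eq_add_of_le hnk
  have hsub : Finset.range (k + (m + 1)) ⊆ Finset.range N :=
    Finset.range_subset_range.2 (by omega)
  rw [← Finset.sum_subset hsub fun j _ hj => by
      rw [gsMatrix_eq_zero hq0 p A (by rw [Finset.mem_range] at hj; omega), zero_mul],
    Finset.sum_range_add, Finset.sum_eq_zero fun j hj => by
      rw [gsMatrixInv_eq_zero hq0 p A (Finset.mem_range.1 hj), mul_zero], zero_add]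
  have hcast : ∀ a b : ℕ, ((a + b : ℕ) : ℤ) - a = (b : ℤ) := fun a b => by push_cast; ring
  rcases m with _ | m
  · have h0 : 1 - A * p ^ k * q ^ k ≠ 0 := sub_ne_zero.2 (hA k).symm
    have h1 : A * q ^ k * p ^ ((k : ℤ) - 1) * p = A * p ^ k * q ^ k := by
      rw [zpow_sub_one₀ hp0, zpow_natCast]
      field_simp
    simp only [zero_add, Finset.sum_range_one, add_zero, gsMatrix, gsMatrixInv, sub_self,
      qPoch_zero, zero_sub, qPoch_neg_one, inv_inv, h1, Nat.sub_self, pow_zero, div_one, one_mul,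
      mul_inv_cancel₀ h0, mul_one, if_true]
    rw [show Nat.choose 1 2 = 0 from rfl, zero_add, zpow_neg, ← Nat.cast_mul, zpow_natCast]
    exact inv_mul_cancel₀ (pow_ne_zero _ hq0)
  · rw [if_neg (by omega)]
    have hterm : ∀ l ∈ Finset.range (m + 1 + 1),
        gsMatrix p q A (k + (m + 1)) (k + l) * gsMatrixInv p q A (k + l) k =
          (1 - A * p ^ k * q ^ k) *
            (Lagrange.nodalWeight (Finset.range (m + 1 + 1)) (fun i => q ^ k * q ^ i) l *
              poleProd (fun i => A * p ^ (k + 1 + i)) m (q ^ k * q ^ l)) := by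
      intro l hl
      have hl' : l ≤ m + 1 := Nat.lt_succ_iff.1 (Finset.mem_range.1 hl)
      rw [← qPoch_mul_qPoch_inv hp0 hA k l m hl']
      obtain ⟨d, hd⟩ := Nat.exists_eq_add_of_le hl'
      rw [hd, nodalWeight_mul_pow, gsMatrix, gsMatrixInv, hcast,
        show (((k + (l + d) : ℕ) : ℤ) - ((k + l : ℕ) : ℤ)) = (d : ℤ) by push_cast; ring,
        show l + d - l = d by omega, show k + l - k = l by omega]
      have hpow : q ^ (-(((k + (l + d) : ℕ) : ℤ) * ((k + l : ℕ) : ℤ))) *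
          q ^ ((l + 1).choose 2 + (k + l) * k) =
          ((q ^ k) ^ (l + d))⁻¹ * q ^ (((l + 1).choose 2 : ℤ) - (l + d) * l) := by
        rw [← pow_mul, ← zpow_natCast, ← zpow_natCast, ← zpow_neg, ← zpow_add₀ hq0,
          ← zpow_add₀ hq0]
        congr 1
        push_cast
        ring
      rw [mul_left_comm ((q ^ k) ^ (l + d))⁻¹, ← hpow]
      ring
    rw [Finset.sum_congr rfl hterm, ← Finset.mul_sum]
    have h := dividedDiff_poleProd
      (injective_mul_pow hq0 hq (pow_ne_zero k hq0)) (fun i => A * p ^ (k + 1 + i)) m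
    rw [dividedDiff] at h
    rw [h, mul_zero]

/-- Lower triangular matrices `S` and `T` with `S T = 1` invert the corresponding sequence
transforms, since a one-sided inverse of each finite section is two-sided. -/
lemma triangular_inversion {S T : ℕ → ℕ → ℂ} (hS : ∀ n k, n < k → S n k = 0)
    (hT : ∀ n k, n < k → T n k = 0)
    (h : ∀ n N, n < N → ∀ k, ∑ j ∈ Finset.range N, S n j * T j k = if n = k then 1 else 0)
    (u v : ℕ → ℂ) :
    (∀ n, u n = ∑ k ∈ Finset.range (n + 1), S n k * v k) ↔
      (∀ n, v n = ∑ k ∈ Finset.range (n + 1), T n k * u k) := by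
  have hext : ∀ {U : ℕ → ℕ → ℂ}, (∀ n k, n < k → U n k = 0) → ∀ (w : ℕ → ℂ) {n N : ℕ}, n < N →
      ∑ k ∈ Finset.range (n + 1), U n k * w k = ∑ k : Fin N, U n k * w k := by
    intro U hU w n N hnN
    rw [Fin.sum_univ_eq_sum_range (fun k => U n k * w k)]
    refine Finset.sum_subset (Finset.range_subset_range.2 hnN) fun k _ hk => ?_
    rw [hU n k (by rw [Finset.mem_range] at hk; omega), zero_mul]
  have hone : ∀ N : ℕ, (Matrix.of fun i j : Fin N => S i j) *
      (Matrix.of fun i j : Fin N => T i j) = 1 := by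
    intro N
    ext i k
    rw [Matrix.mul_apply, Matrix.one_apply]
    simp only [Matrix.of_apply]
    rw [Fin.sum_univ_eq_sum_range (fun j => S i j * T j k), h i N i.2 k]
    simp only [Fin.ext_iff]
  have hvec : ∀ {U : ℕ → ℕ → ℂ}, (∀ n k, n < k → U n k = 0) → ∀ f g : ℕ → ℂ,
      (∀ n, f n = ∑ k ∈ Finset.range (n + 1), U n k * g k) ↔
      ∀ N : ℕ, (fun i : Fin N => f i) =
        (Matrix.of fun i j : Fin N => U i j).mulVec (fun i : Fin N => g i) := by
    intro U hU f g
    constructor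
    · intro hf N
      ext i
      rw [hf i, hext hU g i.2]
      rfl
    · intro hf n
      rw [hext hU g n.lt_succ_self]
      exact congrFun (hf (n + 1)) (Fin.last n)
  rw [hvec hS, hvec hT]
  constructor
  · intro hu N
    rw [hu N, Matrix.mulVec_mulVec, mul_eq_one_comm.1 (hone N), Matrix.one_mulVec]
  · intro hv N
    rw [hv N, Matrix.mulVec_mulVec, hone N, Matrix.one_mulVec]

/-! ### Expansions with poles along a geometric progression -/

/-- Poles at the points `1 / (A p ^ i)` for `i ≥ 1`; the entry `0` at `i = 0` stands for a pole at
infinity. -/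
def geomPoles (A p : ℂ) (i : ℕ) : ℂ := if i = 0 then 0 else A * p ^ i

lemma poleProd_geomPoles (A p y : ℂ) (n : ℕ) :
    poleProd (geomPoles A p) (n + 1) y = qPoch (A * p * y) p n := by
  rw [poleProd, Finset.prod_range_succ', qPoch_natCast]
  simp only [geomPoles, if_true, zero_mul, sub_zero, mul_one, Nat.succ_ne_zero, if_false]
  refine Finset.prod_congr rfl fun i _ => ?_
  ring

lemma tendsto_geomPoles (A : ℂ) {p : ℂ} (hp : ‖p‖ < 1) :
    Tendsto (geomPoles A p) atTop (𝓝 0) := by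
  refine (tendsto_mul_pow_zero hp A).congr' ?_
  filter_upwards [eventually_gt_atTop 0] with i hi
  rw [geomPoles, if_neg hi.ne']

lemma one_sub_geomPoles_ne_zero {A p x : ℂ} (h : ∀ i : ℕ, A * p ^ (i + 1) * x ≠ 1) (i : ℕ) :
    1 - geomPoles A p i * x ≠ 0 := by
  rcases i with _ | i
  · simp [geomPoles]
  · rw [geomPoles, if_neg i.succ_ne_zero]
    exact sub_ne_zero.2 (h i).symm

/-- The convention `(a;p)_{-1} = 1 / (1 - a / p)` makes the term with index `0` conform to the
general shape. -/
lemma ratBasis_mul_dividedDiff_geomPoles {A p : ℂ} (hp0 : p ≠ 0) {z : ℕ → ℂ}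
    (hA : A * z 0 ≠ 1) (F : ℂ → ℂ) (x : ℂ) (n : ℕ) :
    ratBasis (geomPoles A p) z n x *
        dividedDiff z n (fun y => poleProd (geomPoles A p) n y * F y) =
      (1 - A * p ^ n * z n) * ((∏ i ∈ Finset.range n, (x - z i)) / qPoch (A * p * x) p n) *
        dividedDiff z n (fun y => F y * qPoch (A * p * y) p ((n : ℤ) - 1)) := by
  rw [ratBasis, poleProd_geomPoles]
  rcases n with _ | n
  · have h0 : 1 - A * z 0 ≠ 0 := sub_ne_zero.2 hA.symm
    have h1 : A * p * z 0 * p⁻¹ = A * z 0 := by field_simp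
    simp only [dividedDiff, zero_add, Finset.sum_range_one, Nat.cast_zero, zero_sub,
      qPoch_neg_one, qPoch_zero, h1, geomPoles, if_true, poleProd, Finset.prod_range_zero,
      pow_zero, zero_mul, sub_zero, div_one, mul_one, one_mul]
    rw [mul_left_comm, mul_left_comm (1 - A * z 0), mul_inv_cancel₀ h0, mul_one]
  · rw [show ((n + 1 : ℕ) : ℤ) - 1 = (n : ℤ) by push_cast; ring]
    simp only [poleProd_geomPoles]
    rw [geomPoles, if_neg n.succ_ne_zero]
    simp only [mul_comm (F _)]

/-- The coefficients `G₃(n)` as divided differences. -/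
lemma coeffG3_eq (p q A : ℂ) (F : ℂ → ℂ) (n : ℕ) :
    coeffG3 p q A F n = (-1) ^ n * (qPoch q q n * dividedDiff (fun i => 1 * q ^ i) n
      (fun y => F y * qPoch (A * p * y) p ((n : ℤ) - 1))) := by
  rw [qPoch_mul_dividedDiff, coeffG3, one_pow, inv_one, one_mul, Finset.mul_sum]
  refine Finset.sum_congr rfl fun k hk => ?_
  obtain ⟨l, rfl⟩ := Nat.exists_eq_add_of_le (Nat.lt_succ_iff.1 (Finset.mem_range.1 hk))
  have h : (-1 : ℂ) ^ (k + l) * (-1) ^ k = (-1) ^ l := by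
    rw [pow_add, mul_right_comm, ← mul_pow]
    simp
  rw [Nat.add_sub_cancel_left, one_mul, ← h]
  ring

/-- The coefficients `G₄(n)` as divided differences. -/
lemma coeffG4_eq (q a : ℂ) (F : ℂ → ℂ) (n : ℕ) :
    coeffG4 q a F n = qPoch q q n * dividedDiff (fun i => a * q * q ^ i) n
      (fun y => F y * qPoch y q ((n : ℤ) - 1)) := by
  rw [qPoch_mul_dividedDiff, coeffG4, mul_pow, one_div]
  congr 1
  refine Finset.sum_congr rfl fun k _ => ?_
  rw [show a * q * q ^ k = a * q ^ (k + 1) by ring]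
  ring

/-- The expansion with nodes `q ^ i` and poles `1 / (A p ^ i)`. -/
lemma hasSum_coeffG3 {p q : ℂ} (hp0 : p ≠ 0) (hp : ‖p‖ < 1) (hq0 : q ≠ 0) (hq : ‖q‖ < 1)
    {R : ℝ} {F : ℂ → ℂ} (hF : DifferentiableOn ℂ F (Metric.ball 0 R)) {A : ℂ} (hA : A ≠ 1)
    {x : ℂ} (hx : ‖x‖ < R) (hAx : ∀ i : ℕ, A * p ^ (i + 1) * x ≠ 1) :
    HasSum (fun k : ℕ => coeffG3 p q A F k * (1 - A * p ^ k * q ^ k) *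
      ((∏ i ∈ Finset.range k, (q ^ i - x)) / (qPoch q q k * qPoch (A * p * x) p k))) (F x) := by
  convert hasSum_dividedDiff (injective_mul_pow hq0 hq one_ne_zero) (tendsto_mul_pow_zero hq 1)
    (tendsto_geomPoles A hp) (one_sub_geomPoles_ne_zero hAx) hF hx using 2 with n
  rw [ratBasis_mul_dividedDiff_geomPoles hp0 (by simpa using hA), coeffG3_eq]
  have h1 : ∏ i ∈ Finset.range n, (q ^ i - x) =
      (-1) ^ n * ∏ i ∈ Finset.range n, (x - 1 * q ^ i) := by
    rw [← Finset.card_range n, ← Finset.prod_const, Finset.card_range,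
      ← Finset.prod_mul_distrib]
    refine Finset.prod_congr rfl fun i _ => ?_
    ring
  have h2 : (-1 : ℂ) ^ n * (-1) ^ n = 1 := by
    rw [← mul_pow]
    simp
  have h3 := qPoch_self_ne_zero hq n
  rw [h1, one_mul]
  generalize dividedDiff _ n _ = D
  generalize ∏ i ∈ Finset.range n, (x - 1 * q ^ i) = P
  calc _ = ((-1 : ℂ) ^ n * (-1) ^ n) * (qPoch q q n / qPoch q q n) *
        ((1 - A * p ^ n * q ^ n) * (P / qPoch (A * p * x) p n) * D) := by ring
    _ = _ := by rw [h2, div_self h3, one_mul, one_mul]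

/-- Liu's expansion, with nodes `a q ^ (i + 1)` and poles `q ^ (-i)`. -/
lemma hasSum_coeffG4 {q : ℂ} (hq0 : q ≠ 0) (hq : ‖q‖ < 1)
    {R : ℝ} {F : ℂ → ℂ} (hF : DifferentiableOn ℂ F (Metric.ball 0 R)) {a : ℂ} (ha0 : a ≠ 0)
    (ha : a ≠ 1) {x : ℂ} (hx0 : x ≠ 0) (hx : ‖x‖ < R) (hxq : ∀ i : ℕ, x * q ^ i ≠ 1) :
    HasSum (fun k : ℕ => coeffG4 q a F k *
      ((1 - a * q ^ (2 * k)) * qPoch (a * q / x) q k * x ^ k /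
        (qPoch q q k * qPoch x q k))) (F x) := by
  have hpole : ∀ i : ℕ, q⁻¹ * q ^ (i + 1) * x ≠ 1 := fun i => by
    rw [pow_succ', inv_mul_cancel_left₀ hq0, mul_comm]
    exact hxq i
  convert hasSum_dividedDiff (injective_mul_pow hq0 hq (mul_ne_zero ha0 hq0))
    (tendsto_mul_pow_zero hq (a * q)) (tendsto_geomPoles q⁻¹ hq)
    (one_sub_geomPoles_ne_zero hpole) hF hx using 2 with n
  rw [ratBasis_mul_dividedDiff_geomPoles hq0 (by
    rw [pow_zero, mul_one, mul_comm, mul_inv_cancel_right₀ hq0]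
    exact ha), coeffG4_eq]
  have h1 : qPoch (a * q / x) q n * x ^ n = ∏ i ∈ Finset.range n, (x - a * q * q ^ i) := by
    rw [qPoch_natCast, ← Finset.card_range n, ← Finset.prod_const, Finset.card_range,
      ← Finset.prod_mul_distrib]
    refine Finset.prod_congr rfl fun i _ => ?_
    field_simp
  have h2 : q⁻¹ * q ^ n * (a * q * q ^ n) = a * q ^ (2 * n) := by
    field_simp
    ring
  have h3 := qPoch_self_ne_zero hq n
  simp only [inv_mul_cancel₀ hq0, one_mul, h2]
  rw [← h1]
  field_simp

/-! ### Confluent nodes -/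

/-- Contour integral form of the iterated `q`-difference operator. -/
lemma iterate_qDiff_eq_circleIntegral {q : ℂ} (hq0 : q ≠ 0) (hq : ‖q‖ < 1) {r : ℝ} (hr : 0 < r)
    {F : ℂ → ℂ} (hF : DifferentiableOn ℂ F (Metric.closedBall 0 r)) (b : ℕ → ℂ) (n : ℕ) {y : ℂ}
    (hy0 : y ≠ 0) (hy : ‖y‖ < r) :
    (qDiff q)^[n] (fun y => F y * poleProd b n y) y =
      qPoch q q n * ∮ w in C(0, r), (2 * Real.pi * Complex.I : ℂ)⁻¹ * F w *
        (poleProd b n w / ∏ i ∈ Finset.range (n + 1), (w - y * q ^ i)) := by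
  have hnode : ∀ i, ‖y * q ^ i‖ < r := fun i => by
    rw [norm_mul, norm_pow]
    exact (mul_le_of_le_one_right (norm_nonneg y) (pow_le_one₀ (norm_nonneg q) hq.le)).trans_lt hy
  rw [iterate_qDiff hq0 hq _ n y hy0, ← dividedDiff_cauchyIntegral
    (injective_mul_pow hq0 hq hy0) hr.le (fun w hw i h => (hnode i).ne (by
      rw [← h]
      simpa using hw)) (φ := fun w => (2 * Real.pi * Complex.I : ℂ)⁻¹ * F w)
    (continuousOn_const.mul (hF.continuousOn.mono Metric.sphere_subset_closedBall))]
  congr 1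
  refine dividedDiff_congr fun k => ?_
  have h := DiffContOnCl.two_pi_i_inv_smul_circleIntegral_sub_inv_smul
    (DifferentiableOn.diffContOnCl (by rwa [closure_ball _ hr.ne']))
    (show y * q ^ k ∈ Metric.ball 0 r by simpa using hnode k) (f := F)
  rw [mul_comm, ← h, smul_eq_mul, ← circleIntegral.integral_const_mul]
  congr 2
  ext w
  simp only [smul_eq_mul]
  ring

lemma tendsto_circleIntegral_nodes {r : ℝ} (hr : 0 < r) {ψ : ℂ → ℂ}
    (hψ : ContinuousOn ψ (Metric.sphere 0 r)) {q : ℂ} (hq : ‖q‖ < 1) (n : ℕ) :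
    Tendsto (fun y => ∮ w in C(0, r), ψ w / ∏ i ∈ Finset.range (n + 1), (w - y * q ^ i)) (𝓝 0)
      (𝓝 (∮ w in C(0, r), ψ w / w ^ (n + 1))) := by
  have hcont : ContinuousOn (Function.uncurry fun y w : ℂ =>
      ψ w / ∏ i ∈ Finset.range (n + 1), (w - y * q ^ i))
      (Metric.closedBall 0 (r / 2) ×ˢ Metric.sphere 0 r) := by
    refine ContinuousOn.div (hψ.comp continuousOn_snd fun t ht => ht.2) (by fun_prop) ?_
    rintro ⟨y, w⟩ ⟨hy, hw⟩
    refine Finset.prod_ne_zero_iff.2 fun i _ h => ?_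
    have h1 : ‖w‖ = r := by simpa using hw
    have h2 : ‖y‖ ≤ r / 2 := by simpa using hy
    have h3 : ‖w‖ ≤ ‖y‖ := by
      rw [show w = y * q ^ i from sub_eq_zero.1 h, norm_mul, norm_pow]
      exact mul_le_of_le_one_right (norm_nonneg y) (pow_le_one₀ (norm_nonneg q) hq.le)
    linarith
  have hunif := (((isCompact_closedBall (0 : ℂ) (r / 2)).prod
    (isCompact_sphere (0 : ℂ) r)).uniformContinuousOn_of_continuous hcont).tendstoUniformlyOn
    (F := fun y w : ℂ => ψ w / ∏ i ∈ Finset.range (n + 1), (w - y * q ^ i))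
    (Metric.mem_closedBall_self (half_pos hr).le)
  have hmem := Metric.closedBall_mem_nhds (0 : ℂ) (half_pos hr)
  rw [nhdsWithin_eq_nhds.2 hmem] at hunif
  have := hunif.tendsto_circleIntegral_of_continuousOn hr.le (by
    filter_upwards [hmem] with y hy
    exact hcont.comp (f := fun w => (y, w)) (by fun_prop) fun w hw => ⟨hy, hw⟩)
  simpa using this

/-- Carlitz's expansion: the case in which all nodes coincide with `0`, so that the divided
differences become Taylor coefficients. -/
lemma exists_carlitz_expansion {q : ℂ} (hq0 : q ≠ 0) (hq : ‖q‖ < 1) {R : ℝ} (hR : 0 < R)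
    {F : ℂ → ℂ} (hF : DifferentiableOn ℂ F (Metric.ball 0 R)) :
    ∃ C : ℕ → ℂ,
      (∀ k : ℕ, Tendsto ((qDiff q)^[k] (fun y => F y * qPoch y q ((k : ℤ) - 1)))
        (𝓝[≠] 0) (𝓝 (C k))) ∧
      (∀ x : ℂ, ‖x‖ < R → (∀ i : ℕ, x * q ^ i ≠ 1) →
        HasSum (fun k : ℕ => x ^ k / (qPoch q q k * qPoch x q k) * C k) (F x)) := by
  have hpole1 : ∀ y, q⁻¹ * q * y = y := fun y => by rw [inv_mul_cancel₀ hq0, one_mul]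
  set b := geomPoles q⁻¹ q with hb
  have hpoly : ∀ n y, poleProd b (n + 1) y = qPoch y q n := fun n y => by
    rw [hb, poleProd_geomPoles, hpole1]
  -- the `n`-th Taylor coefficient of `F * poleProd b n`, as a Cauchy integral of radius `r`
  set T : ℝ → ℕ → ℂ := fun r n => ∮ w in C(0, r), (2 * Real.pi * Complex.I : ℂ)⁻¹ * F w *
    (poleProd b n w / w ^ (n + 1)) with hT
  have hdiff : ∀ r < R, DifferentiableOn ℂ F (Metric.closedBall 0 r) := fun r hr =>
    hF.mono (Metric.closedBall_subset_ball hr)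
  have hlim : ∀ r, 0 < r → r < R → ∀ k : ℕ,
      Tendsto ((qDiff q)^[k] (fun y => F y * qPoch y q ((k : ℤ) - 1))) (𝓝[≠] 0)
        (𝓝 (qPoch q q k * T r k)) := by
    intro r hr hrR k
    have hpolycont : Continuous (poleProd b k) := by
      unfold poleProd
      fun_prop
    have h1 := (tendsto_circleIntegral_nodes hr (ψ := fun w =>
      (2 * Real.pi * Complex.I : ℂ)⁻¹ * F w * poleProd b k w)
      ((continuousOn_const.mul ((hdiff r hrR).continuousOn.mono
        Metric.sphere_subset_closedBall)).mul hpolycont.continuousOn) hq k).const_mul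
          (qPoch q q k)
    simp only [mul_div_assoc] at h1
    have h2 : Tendsto ((qDiff q)^[k] fun y => F y * poleProd b k y) (𝓝[≠] 0)
        (𝓝 (qPoch q q k * T r k)) := by
      refine (h1.mono_left nhdsWithin_le_nhds).congr' ?_
      filter_upwards [self_mem_nhdsWithin,
        mem_nhdsWithin_of_mem_nhds (Metric.ball_mem_nhds (0 : ℂ) hr)] with y hy0 hy
      exact (iterate_qDiff_eq_circleIntegral hq0 hq hr (hdiff r hrR) b k hy0
        (by simpa using hy)).symm
    rcases k with _ | k
    · -- here the two functions differ by the factor `1 / (1 - y / q)`, which tends to `1`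
      have h3 : Tendsto (fun y : ℂ => qPoch y q (-1)) (𝓝[≠] 0) (𝓝 1) := by
        simp only [qPoch_neg_one]
        have : ContinuousAt (fun y : ℂ => (1 - y * q⁻¹)⁻¹) 0 :=
          ContinuousAt.inv₀ (by fun_prop) (by simp)
        simpa using this.tendsto.mono_left nhdsWithin_le_nhds
      have h4 := h2.mul h3
      simpa [poleProd] using h4
    · simp only [hpoly] at h2
      rw [show ((k + 1 : ℕ) : ℤ) - 1 = (k : ℤ) by push_cast; ring]
      exact h2
  refine ⟨fun k => qPoch q q k * T (R / 2) k, hlim _ (half_pos hR) (half_lt_self hR), ?_⟩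
  intro x hx hxq
  obtain ⟨r, hxr, hrR⟩ := exists_between hx
  have hr : 0 < r := (norm_nonneg x).trans_lt hxr
  have hTr : ∀ k : ℕ, qPoch q q k * T (R / 2) k = qPoch q q k * T r k := fun k =>
    tendsto_nhds_unique (hlim _ (half_pos hR) (half_lt_self hR) k) (hlim r hr hrR k)
  have hpole : ∀ i : ℕ, q⁻¹ * q ^ (i + 1) * x ≠ 1 := fun i => by
    rw [pow_succ', inv_mul_cancel_left₀ hq0, mul_comm]
    exact hxq i
  have hnorm : ∀ w ∈ Metric.sphere (0 : ℂ) r, ‖w‖ = r := fun w hw => by simpa using hw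
  have h := hasSum_circleIntegral_kernel (z := fun _ => 0) tendsto_const_nhds
    (tendsto_geomPoles q⁻¹ hq) (one_sub_geomPoles_ne_zero hpole) hr.le hxr
    (fun w hw => (hnorm w hw).ge)
    (fun w hw _ h0 => hr.ne' (by rw [← hnorm w hw, h0, norm_zero]))
    (φ := fun w => (2 * Real.pi * Complex.I : ℂ)⁻¹ * F w)
    (continuousOn_const.mul ((hdiff r hrR).continuousOn.mono Metric.sphere_subset_closedBall))
  have hcauchy := DiffContOnCl.two_pi_i_inv_smul_circleIntegral_sub_inv_smul
    (DifferentiableOn.diffContOnCl (by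
      rw [closure_ball _ hr.ne']
      exact hdiff r hrR)) (show x ∈ Metric.ball 0 r by simpa using hxr) (f := F)
  convert h using 1
  · ext n
    have h3 := qPoch_self_ne_zero hq n
    simp only [hTr]
    rw [ratBasis, ← hb, hpoly]
    simp only [hT, sub_zero, mul_zero, one_mul, Finset.prod_const, Finset.card_range]
    field_simp
  · rw [← hcauchy, smul_eq_mul, ← circleIntegral.integral_const_mul]
    congr 1
    ext w
    simp only [smul_eq_mul]
    ring

/-- The sum of a power series that converges in the disc of radius `R` is holomorphic there. -/
lemma differentiableOn_of_hasSum {α : ℕ → ℂ} {R : ℝ} (hR : 0 < R)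
    (hrad : (FormalMultilinearSeries.ofScalars ℂ α).radius = ENNReal.ofReal R) {F : ℂ → ℂ}
    (hF : ∀ x : ℂ, ‖x‖ < R → HasSum (fun n : ℕ => α n * x ^ n) (F x)) :
    DifferentiableOn ℂ F (Metric.ball 0 R) := by
  have h := (FormalMultilinearSeries.ofScalars ℂ α).hasFPowerSeriesOnBall
    (by rw [hrad]; exact ENNReal.ofReal_pos.2 hR)
  have h1 := h.differentiableOn
  rw [hrad, Metric.eball_ofReal] at h1
  refine h1.congr fun x hx => ?_
  rw [← (hF x (by simpa using hx)).tsum_eq]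
  exact (FormalMultilinearSeries.ofScalars_sum_eq α x).symm

end

theorem mainTheorem3
    (p q : ℂ) (hp0 : p ≠ 0) (hp : ‖p‖ < 1) (hq0 : q ≠ 0) (hq : ‖q‖ < 1)
    (α : ℕ → ℂ) (R : ℝ) (hR : 0 < R)
    (hrad : (FormalMultilinearSeries.ofScalars ℂ α).radius = ENNReal.ofReal R)
    (hRq : ∀ n : ℕ, (R : ℂ) ≠ q ^ n)
    (c₀ : ℂ) (hc₀ : Tendsto (fun n => α (n + 1) / α n) atTop (𝓝 c₀))
    (m M : ℝ) (hm : ∀ n : ℕ, 0 < m * ‖c₀‖ ^ n)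
    (hlow : ∀ n : ℕ, m * ‖c₀‖ ^ n ≤ ‖α n‖) (hup : ∀ n : ℕ, ‖α n‖ ≤ M * ‖c₀‖ ^ n)
    (F : ℂ → ℂ) (hF : ∀ x : ℂ, ‖x‖ < R → HasSum (fun n : ℕ => α n * x ^ n) (F x)) :
    -- the expansion with nodes `q^i` and parameters `A p^i`
    (∀ A : ℂ, A ≠ 1 → ∀ x : ℂ, ‖x‖ < R → (∀ i : ℕ, A * p ^ (i + 1) * x ≠ 1) →
      HasSum (fun k : ℕ => coeffG3 p q A F k * (1 - A * p ^ k * q ^ k) *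
        ((∏ i ∈ Finset.range k, (q ^ i - x)) / (qPoch q q k * qPoch (A * p * x) p k))) (F x)) ∧
    -- the Gessel--Stanton inversion
    (∀ A : ℂ, (∀ k : ℕ, A * p ^ k * q ^ k ≠ 1) → ∀ u v : ℕ → ℂ,
      ((∀ n, u n = ∑ k ∈ Finset.range (n + 1), gsMatrix p q A n k * v k) ↔
        (∀ n, v n = ∑ k ∈ Finset.range (n + 1), gsMatrixInv p q A n k * u k))) ∧
    -- Liu's expansion, and its coefficients through the `q`-difference operator
    (∀ a : ℂ, a ≠ 0 → a ≠ 1 →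
      (∀ x : ℂ, x ≠ 0 → ‖x‖ < R → (∀ i : ℕ, x * q ^ i ≠ 1) →
        HasSum (fun k : ℕ => coeffG4 q a F k *
          ((1 - a * q ^ (2 * k)) * qPoch (a * q / x) q k * x ^ k /
            (qPoch q q k * qPoch x q k))) (F x)) ∧
      (∀ k : ℕ, coeffG4 q a F k =
        (qDiff q)^[k] (fun y => F y * qPoch y q ((k : ℤ) - 1)) (a * q))) ∧
    -- Carlitz's expansion; `C k` is the value at `0` of the `k`-th `q`-difference
    (∃ C : ℕ → ℂ,
      (∀ k : ℕ, Tendsto ((qDiff q)^[k] (fun y => F y * qPoch y q ((k : ℤ) - 1)))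
        (𝓝[≠] 0) (𝓝 (C k))) ∧
      (∀ x : ℂ, ‖x‖ < R → (∀ i : ℕ, x * q ^ i ≠ 1) →
        HasSum (fun k : ℕ => x ^ k / (qPoch q q k * qPoch x q k) * C k) (F x))) := by
  have hFd := differentiableOn_of_hasSum hR hrad hF
  refine ⟨fun A hA x hx hAx => hasSum_coeffG3 hp0 hp hq0 hq hFd hA hx hAx,
    fun A hA u v => triangular_inversion (fun n k => gsMatrix_eq_zero hq0 p A)
      (fun n k => gsMatrixInv_eq_zero hq0 p A)
      (fun n N hn k => sum_gsMatrix_mul_gsMatrixInv hp0 hq0 hq hA hn k) u v,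
    fun a ha0 ha => ⟨fun x hx0 hx hxq => hasSum_coeffG4 hq0 hq hFd ha0 ha hx0 hx hxq,
      fun k => ?_⟩,
    exists_carlitz_expansion hq0 hq hR hFd⟩
  rw [coeffG4_eq, iterate_qDiff hq0 hq _ k _ (mul_ne_zero ha0 hq0)]
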